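/- Let $k$ be an uncountable field and let $R$ be an associative unital $k$-algebra with Jacobson radical $J(R)$. If the quotient ring $R/J(R)$ is not commutative, then the multiplicative semigroup of $R$ contains a free noncyclic subsemigroup, that is, a subsemigroup which is free on a set of at least two generators. -/

import Mathlib

/-- The subsemigroup `S` of the semigroup `M` is free and noncyclic: it has a free basis `X`
with at least two elements, that is, `X` generates `S` and the canonical homomorphism from the
free semigroup (nonempty words) on `X` to `M` is injective. -/
def IsFreeNoncyclicSubsemigroup {M : Type*} [Semigroup M] (S : Subsemigroup M) : Prop :=
  ∃ X : Set M, X.Nontrivial ∧ Subsemigroup.closure X = S ∧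
    Function.Injective (FreeSemigroup.lift (fun x : X => (x : M)))

/-- The ring `R` is noncommutative modulo its Jacobson radical: the quotient ring of `R` by its
Jacobson radical is not commutative. -/
def NoncommutativeModJacobson (R : Type*) [Ring R] : Prop :=
  ∃ x y : R ⧸ Ring.jacobson R, x * y ≠ y * x

/-! Suppose `R` has no free pair, and let it act on a simple module `R ⧸ I` for which `I` misses
some commutator. By Zorn, enlarge the image to a maximal subalgebra `B` of `End V` without free
pairs. Since `k` is uncountable, adjoining an element commuting with `B` creates no free pair
(`not_hasFreePair_of_commute`), so `B` contains its centralizer. If the centralizer moves a nonzero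
`v` to every vector, `B` is commutative. Otherwise some `w` is not reached, `B` controls `v` and `w`
independently, and it contains the affine maps `x ↦ t x` and `x ↦ t x + 1` on the line `x v + w`;
these are free for some `t` (`hasFreePair_of_transitive_pair`). Both cases are absurd. -/

/-- The monoid `A` contains two elements which freely generate a free submonoid. -/
def HasFreePair (A : Type*) [Monoid A] : Prop :=
  ∃ a b : A, Function.Injective (FreeMonoid.lift (fun c : Bool => cond c a b))

theorem freeMonoid_lift_cond_map {A B : Type*} [Monoid A] [Monoid B] (φ : A →* B) (a b : A)
    (u : FreeMonoid Bool) :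
    FreeMonoid.lift (fun c : Bool => cond c (φ a) (φ b)) u =
      φ (FreeMonoid.lift (fun c : Bool => cond c a b) u) := by
  have : FreeMonoid.lift (fun c : Bool => cond c (φ a) (φ b)) =
      φ.comp (FreeMonoid.lift (fun c : Bool => cond c a b)) := by
    apply FreeMonoid.hom_eq
    rintro (_ | _) <;> simp
  rw [this]; rfl

/-- Free pairs lift along surjective homomorphisms. -/
theorem HasFreePair.of_surjective {A B : Type*} [Monoid A] [Monoid B] (φ : A →* B)
    (hφ : Function.Surjective φ) (h : HasFreePair B) : HasFreePair A := by
  obtain ⟨a, b, hab⟩ := h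
  obtain ⟨a, rfl⟩ := hφ a
  obtain ⟨b, rfl⟩ := hφ b
  refine ⟨a, b, fun u v huv => hab ?_⟩
  rw [freeMonoid_lift_cond_map, freeMonoid_lift_cond_map, huv]

/-- Free pairs persist along injective homomorphisms. -/
theorem HasFreePair.of_injective {A B : Type*} [Monoid A] [Monoid B] (φ : A →* B)
    (hφ : Function.Injective φ) (h : HasFreePair A) : HasFreePair B := by
  obtain ⟨a, b, hab⟩ := h
  refine ⟨φ a, φ b, fun u v huv => hab (hφ ?_)⟩
  rwa [freeMonoid_lift_cond_map, freeMonoid_lift_cond_map] at huv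

theorem exists_relation_of_not_hasFreePair {A : Type*} [Monoid A] (h : ¬ HasFreePair A) (a b : A) :
    ∃ p : FreeMonoid Bool × FreeMonoid Bool, p.1 ≠ p.2 ∧
      FreeMonoid.lift (fun c : Bool => cond c a b) p.1 =
        FreeMonoid.lift (fun c : Bool => cond c a b) p.2 := by
  by_contra! hcon
  refine h ⟨a, b, fun u v huv => ?_⟩
  by_contra hne
  exact hcon (u, v) hne huv

/-- A pair of elements generating a free submonoid generates a free noncyclic subsemigroup. -/
theorem HasFreePair.exists_isFreeNoncyclicSubsemigroup {A : Type*} [Monoid A]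
    (h : HasFreePair A) : ∃ S : Subsemigroup A, IsFreeNoncyclicSubsemigroup S := by
  obtain ⟨a, b, hab⟩ := h
  have hne : a ≠ b := by
    intro hab'
    have := @hab (FreeMonoid.of true) (FreeMonoid.of false) (by simpa using hab')
    exact absurd (FreeMonoid.of_injective this) (by decide)
  have hbit : ∀ x : ({a, b} : Set A), ∃ c : Bool, cond c a b = x := by
    rintro ⟨x, rfl | rfl⟩
    · exact ⟨true, rfl⟩
    · exact ⟨false, rfl⟩
  choose e he using hbit
  have hinj : Function.Injective e := fun x y hxy => by
    apply Subtype.ext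
    rw [← he x, ← he y, hxy]
  refine ⟨_, {a, b}, Set.nontrivial_pair hne, rfl, ?_⟩
  have key : ∀ u : FreeSemigroup ({a, b} : Set A),
      FreeSemigroup.lift (fun x : ({a, b} : Set A) => (x : A)) u =
        FreeMonoid.lift (fun c : Bool => cond c a b)
          (FreeMonoid.ofList (e u.head :: u.tail.map e)) := by
    intro u
    induction u using FreeSemigroup.recOnMul with
    | ih1 x => simp [FreeSemigroup.of, FreeMonoid.lift_apply, he]
               rfl
    | ih2 x y hx hy =>
      rw [map_mul, hx, hy, ← map_mul]
      simp [FreeSemigroup.head_mul, FreeSemigroup.tail_mul]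
  intro u v huv
  rw [key, key] at huv
  have h2 := FreeMonoid.ofList.injective (hab huv)
  rw [List.cons.injEq] at h2
  exact FreeSemigroup.ext (hinj h2.1) (List.map_injective_iff.2 hinj h2.2)

/-! ### Specialisation over an uncountable field -/

/-- A countable union of finite sets is countable. Used with `ι` the pairs of words: a single
relation then holds for infinitely many parameters. -/
theorem exists_infinite_setOf_of_countable {k ι : Type*} [Uncountable k] [Countable ι]
    {P : k → ι → Prop} (h : ∀ t, ∃ i, P t i) : ∃ i, {t | P t i}.Infinite := by
  by_contra! hcon
  have : (Set.univ : Set k) = ⋃ i, {t | P t i} := by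
    ext t; simpa using h t
  have hc : (Set.univ : Set k).Countable := by
    rw [this]
    exact Set.countable_iUnion fun i => (Set.not_infinite.1 (by simpa using hcon i)).countable
  exact Set.not_countable_univ hc

open Polynomial in
-- Roots cannot be counted in `A`, but linear functionals turn `p` into polynomials over `k`, where
-- they can.
theorem eq_zero_of_infinite_eval_algebraMap_eq_zero {k A : Type*} [Field k] [Ring A] [Algebra k A]
    (p : A[X]) (h : {t : k | p.eval (algebraMap k A t) = 0}.Infinite) : p = 0 := by
  ext n
  rw [coeff_zero, ← Module.forall_dual_apply_eq_zero_iff k]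
  intro φ
  -- The extra `n` keeps the index `n` in range even beyond the degree of `p`.
  let q : k[X] := ∑ i ∈ Finset.range (p.natDegree + n + 1), C (φ (p.coeff i)) * X ^ i
  have hq : q = 0 := by
    refine eq_zero_of_infinite_isRoot q (h.mono fun t ht => ?_)
    have ht' : p.eval (algebraMap k A t) = 0 := ht
    rw [eval_eq_sum_range' (n := p.natDegree + n + 1) (by omega)] at ht'
    have := congrArg φ ht'
    rw [map_sum, map_zero] at this
    simp only [Set.mem_ofPred_eq, IsRoot.def, q, eval_finsetSum, eval_mul, eval_C, eval_pow, eval_X]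
    rw [← this]
    refine Finset.sum_congr rfl fun i _ => ?_
    rw [← map_pow, ← Algebra.commutes, ← Algebra.smul_def, map_smul, smul_eq_mul, mul_comm]
  have := congrArg (coeff · n) hq
  simpa [q, finsetSum_coeff, coeff_C_mul, coeff_X_pow] using this

open Polynomial in
/-- Over an uncountable field, adjoining a central indeterminate creates no free pairs. -/
theorem HasFreePair.of_polynomial (k : Type*) {A : Type*} [Field k] [Uncountable k] [Ring A]
    [Algebra k A] (h : HasFreePair A[X]) : HasFreePair A := by
  by_contra hA
  obtain ⟨f, g, hfg⟩ := h
  let ev : k → A[X] →+* A := fun t => eval₂RingHom' (RingHom.id A) (algebraMap k A t)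
    fun a => (Algebra.commutes t a).symm
  obtain ⟨⟨u, v⟩, hinf⟩ := exists_infinite_setOf_of_countable (k := k)
    fun t => exists_relation_of_not_hasFreePair hA (ev t f) (ev t g)
  obtain ⟨t, ht, -⟩ := hinf.nonempty
  refine ht (hfg (sub_eq_zero.1
    (eq_zero_of_infinite_eval_algebraMap_eq_zero (k := k) _ (hinf.mono ?_))))
  rintro s ⟨-, hs⟩
  have h1 := freeMonoid_lift_cond_map (ev s : A[X] →* A) f g
  simp only [MonoidHom.coe_coe] at h1
  rw [h1, h1] at hs
  have hev : ∀ p : A[X], p.eval (algebraMap k A s) = ev s p := fun p => by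
    simp [ev, eval₂RingHom', eval₂_eq_eval_map]
  simp only [Set.mem_ofPred_eq]
  rw [hev, map_sub, hs, sub_self]

open Polynomial in
/-- Adjoining an element that commutes with a subalgebra without free pairs creates none. -/
theorem not_hasFreePair_of_commute {k E : Type*} [Field k] [Uncountable k] [Ring E] [Algebra k E]
    (B : Subalgebra k E) (hB : ¬ HasFreePair B) (c : E) (hc : ∀ b ∈ B, b * c = c * b) :
    ∃ B' : Subalgebra k E, B ≤ B' ∧ c ∈ B' ∧ ¬ HasFreePair B' := by
  let ψ : B[X] →+* E := eval₂RingHom' (B.val : B →+* E) c fun b => hc b b.2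
  have hψC : ∀ b : B, ψ (C b) = b := fun b => by simp [ψ, eval₂RingHom']
  have hψX : ψ X = c := by simp [ψ, eval₂RingHom']
  let B' : Subalgebra k E :=
    { ψ.range with
      algebraMap_mem' := fun t => ⟨C (algebraMap k B t), by rw [hψC]; rfl⟩ }
  refine ⟨B', fun b hb => ⟨C ⟨b, hb⟩, hψC _⟩, ⟨X, hψX⟩, fun h => hB ?_⟩
  have h1 : HasFreePair ψ.range := h
  exact HasFreePair.of_polynomial k
    (h1.of_surjective (ψ.rangeRestrict : B[X] →* ψ.range) ψ.rangeRestrict_surjective)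

/-- A subalgebra without free pairs is contained in one that contains its own centralizer. -/
theorem exists_le_not_hasFreePair_centralizer_le {k E : Type*} [Field k] [Uncountable k] [Ring E]
    [Algebra k E] (A : Subalgebra k E) (hA : ¬ HasFreePair A) :
    ∃ B : Subalgebra k E, A ≤ B ∧ ¬ HasFreePair B ∧
      ∀ c : E, (∀ b ∈ B, b * c = c * b) → c ∈ B := by
  obtain ⟨B, hAB, hB, hmax⟩ := zorn_le_nonempty₀ {B : Subalgebra k E | ¬ HasFreePair B}
    (fun C hC hchain B₀ hB₀ => by
      refine ⟨sSup C, ?_, fun B hB => le_sSup hB⟩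
      rintro ⟨a, b, hab⟩
      have hmem : ∀ x : E, x ∈ sSup C → ∃ B ∈ C, x ∈ B := by
        intro x hx
        have : Nonempty C := ⟨⟨B₀, hB₀⟩⟩
        rw [sSup_eq_iSup', ← SetLike.mem_coe,
          Subalgebra.coe_iSup_of_directed hchain.directedOn.directed_val] at hx
        simpa using hx
      -- A free pair has only two members, so it already lies in one algebra of the chain.
      obtain ⟨B₁, h₁, ha⟩ := hmem a a.2
      obtain ⟨B₂, h₂, hb⟩ := hmem b b.2
      obtain ⟨D, hD, hD₁, hD₂⟩ := hchain.directedOn B₁ h₁ B₂ h₂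
      refine hC hD ⟨⟨a, hD₁ ha⟩, ⟨b, hD₂ hb⟩, fun u v huv => hab ?_⟩
      let i := Subalgebra.inclusion (le_sSup hD : D ≤ sSup C)
      have h3 := freeMonoid_lift_cond_map (i : D →* (sSup C : Subalgebra k E))
        ⟨a, hD₁ ha⟩ ⟨b, hD₂ hb⟩
      exact (h3 u).trans ((congrArg i huv).trans (h3 v).symm)) A hA
  refine ⟨B, hAB, hB, fun c hc => ?_⟩
  obtain ⟨B', hBB', hcB', hB'⟩ := not_hasFreePair_of_commute B hB c hc
  exact hmax hB' hBB' hcB'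

/-! ### Free pairs of affine maps -/

open Polynomial in
/-- The polynomial whose coefficients are the digits of a word, `true` standing for the digit `0`
and `false` for the digit `1`. -/
noncomputable def digitPolynomial (k : Type*) [Field k] : List Bool → k[X]
  | [] => 0
  | c :: l => X * digitPolynomial k l + C (cond c 0 1)

/-- The constant coefficient reveals the first letter. Equal length is needed because trailing
`true`s are invisible zero digits. -/
theorem digitPolynomial_injective_of_length_eq {k : Type*} [Field k] :
    ∀ l l' : List Bool, l.length = l'.length →
      digitPolynomial k l = digitPolynomial k l' → l = l'
  | [], [], _, _ => rfl
  | c :: l, c' :: l', hlen, h => by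
    have h0 : c = c' := by
      have := congrArg (Polynomial.coeff · 0) h
      cases c <;> cases c' <;> simp [digitPolynomial] at this ⊢
    subst h0
    have h1 : digitPolynomial k l = digitPolynomial k l' := by
      simpa [digitPolynomial] using h
    rw [digitPolynomial_injective_of_length_eq l l' (by simpa using hlen) h1]

/-- The action on `v` records the length of a word, the action on `w` its digits; together they
determine the word when `t` is generic. -/
theorem lift_cond_apply {k V : Type*} [Field k] [AddCommGroup V] [Module k V] {v w : V} {t : k}
    {f g : Module.End k V} (hfv : f v = t • v) (hfw : f w = w) (hgv : g v = t • v)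
    (hgw : g w = v + w) (u : FreeMonoid Bool) :
    FreeMonoid.lift (fun c : Bool => cond c f g) u v = t ^ u.toList.length • v ∧
      FreeMonoid.lift (fun c : Bool => cond c f g) u w =
        (digitPolynomial k u.toList).eval t • v + w := by
  induction u using FreeMonoid.inductionOn' with
  | one => simp [digitPolynomial]
  | of_mul c u ih =>
    obtain ⟨ih1, ih2⟩ := ih
    rw [map_mul, Module.End.mul_apply, Module.End.mul_apply, ih1, ih2]
    cases c <;>
      simp [digitPolynomial, hfv, hfw, hgv, hgw, smul_smul, pow_succ, add_smul, mul_comm, add_assoc]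

/-- A subalgebra of `End V` over an uncountable field that acts on two vectors in all ways needed
to realise the affine maps `x ↦ t x` and `x ↦ t x + 1` has a free pair. -/
theorem hasFreePair_of_transitive_pair {k V : Type*} [Field k] [Uncountable k] [AddCommGroup V]
    [Module k V] (B : Subalgebra k (Module.End k V)) {v w : V} (hv : v ≠ 0)
    (h1 : ∀ x, ∃ b ∈ B, b v = x ∧ b w = 0) (h2 : ∀ x, ∃ b ∈ B, b w = x ∧ b v = 0) :
    HasFreePair B := by
  by_contra hB
  obtain ⟨p, hp, hpv, hpw⟩ := h1 v
  obtain ⟨q, hq, hqw, hqv⟩ := h2 w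
  obtain ⟨r, hr, hrw, hrv⟩ := h2 (v + w)
  let f : k → B := fun t => ⟨t • p + q, B.add_mem (B.smul_mem hp t) hq⟩
  let g : k → B := fun t => ⟨t • p + r, B.add_mem (B.smul_mem hp t) hr⟩
  obtain ⟨⟨u, u'⟩, hinf⟩ := exists_infinite_setOf_of_countable (k := k)
    fun t => exists_relation_of_not_hasFreePair hB (f t) (g t)
  obtain ⟨-, hne, -⟩ := hinf.nonempty
  have key : ∀ t ∈ {t : k | u ≠ u' ∧ FreeMonoid.lift (fun c : Bool => cond c (f t) (g t)) u =
      FreeMonoid.lift (fun c : Bool => cond c (f t) (g t)) u'},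
      t ^ u.toList.length = t ^ u'.toList.length ∧
      (digitPolynomial k u.toList).eval t = (digitPolynomial k u'.toList).eval t := by
    rintro t ⟨-, ht⟩
    have hval := freeMonoid_lift_cond_map (B.val : B →* Module.End k V) (f t) (g t)
    have ht' := (hval u).trans ((congrArg B.val ht).trans (hval u').symm)
    have hact := lift_cond_apply (f := (f t : Module.End k V)) (g := (g t : Module.End k V))
      (v := v) (w := w) (t := t) (by simp [f, hpv, hqv]) (by simp [f, hpw, hqw])
      (by simp [g, hpv, hrv]) (by simp [g, hpw, hrw])
    have hv1 := ((hact u).1.symm.trans (LinearMap.congr_fun ht' v)).trans (hact u').1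
    have hw1 := ((hact u).2.symm.trans (LinearMap.congr_fun ht' w)).trans (hact u').2
    exact ⟨smul_left_injective k hv hv1, smul_left_injective k hv (add_right_cancel hw1)⟩
  have hlen : (Polynomial.X : Polynomial k) ^ u.toList.length = Polynomial.X ^ u'.toList.length :=
    Polynomial.eq_of_infinite_eval_eq _ _ (hinf.mono fun t ht => by simpa using (key t ht).1)
  have hlen' : u.toList.length = u'.toList.length := by
    simpa using congrArg Polynomial.natDegree hlen
  have hdig : digitPolynomial k u.toList = digitPolynomial k u'.toList :=
    Polynomial.eq_of_infinite_eval_eq _ _ (hinf.mono fun t ht => (key t ht).2)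
  exact hne (FreeMonoid.toList.injective (digitPolynomial_injective_of_length_eq _ _ hlen' hdig))

/-! ### Transitive algebras and their centralizers -/

/-- If the annihilator of `v` kills `w`, then some endomorphism commuting with the transitive
algebra `B` maps `v` to `w`. -/
theorem exists_commuting_apply_eq {k V : Type*} [Field k] [AddCommGroup V] [Module k V]
    (B : Subalgebra k (Module.End k V)) (htrans : ∀ v : V, v ≠ 0 → ∀ x, ∃ b ∈ B, b v = x)
    {v w : V} (hv : v ≠ 0) (h : ∀ b ∈ B, b v = 0 → b w = 0) :
    ∃ c : Module.End k V, (∀ b ∈ B, b * c = c * b) ∧ c v = w := by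
  choose β hβ hβv using htrans v hv
  -- The map `b v ↦ b w` is well defined, hence linear and commuting with `B`.
  have hwd : ∀ b ∈ B, ∀ x, b v = x → b w = β x w := fun b hb x hx => by
    have := h (b - β x) (B.sub_mem hb (hβ x)) (by simp [hx, hβv])
    simpa [sub_eq_zero] using this
  let c : Module.End k V :=
    { toFun := fun x => β x w
      map_add' := fun x y => (hwd (β x + β y) (B.add_mem (hβ x) (hβ y)) _ (by simp [hβv])).symm
      map_smul' := fun t x => (hwd (t • β x) (B.smul_mem (hβ x) t) _ (by simp [hβv])).symm }
  refine ⟨c, fun b hb => LinearMap.ext fun x => ?_, ?_⟩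
  · exact hwd (b * β x) (B.mul_mem hb (hβ x)) _ (by simp [hβv])
  · exact (hwd 1 B.one_mem v (by simp)).symm

/-- A noncommutative transitive algebra of endomorphisms over an uncountable field which contains
its centralizer has a free pair. -/
theorem hasFreePair_of_centralizer_le {k V : Type*} [Field k] [Uncountable k] [AddCommGroup V]
    [Module k V] (B : Subalgebra k (Module.End k V))
    (htrans : ∀ v : V, v ≠ 0 → ∀ x, ∃ b ∈ B, b v = x)
    (hcent : ∀ c : Module.End k V, (∀ b ∈ B, b * c = c * b) → c ∈ B)
    {x y : Module.End k V} (hx : x ∈ B) (hy : y ∈ B) (hxy : x * y ≠ y * x) : HasFreePair B := by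
  obtain ⟨v, hv⟩ : ∃ v : V, v ≠ 0 := by
    by_contra! h0
    exact hxy (LinearMap.ext fun z => (h0 _).trans (h0 _).symm)
  by_cases hall : ∀ w : V, ∃ c : Module.End k V, (∀ b ∈ B, b * c = c * b) ∧ c v = w
  · have hB : ∀ a ∈ B, ∀ b ∈ B, b * a = a * b := by
      intro a ha
      obtain ⟨d, hd, hdv⟩ := hall (a v)
      -- Both `a` and `d` commute with each `c` in the centralizer (`d` because `c ∈ B`), and they
      -- agree at `v`, hence at every `c v`.
      have had : a = d := LinearMap.ext fun z => by
        obtain ⟨c, hc, rfl⟩ := hall z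
        have e1 := LinearMap.congr_fun (hc a ha) v
        have e2 := LinearMap.congr_fun (hd c (hcent c hc)) v
        simp only [Module.End.mul_apply] at e1 e2
        rw [e1, ← hdv, e2]
      rw [had]
      exact hd
    exact absurd (hB y hy x hx) hxy
  · push Not at hall
    obtain ⟨w, hw⟩ := hall
    have hvw : ∃ b ∈ B, b v = 0 ∧ b w ≠ 0 := by
      by_contra! h
      obtain ⟨c, hc, hcv⟩ := exists_commuting_apply_eq B htrans hv h
      exact hw c hc hcv
    obtain ⟨b, hb, hbv, hbw⟩ := hvw
    obtain ⟨e, he, hew⟩ := htrans _ hbw w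
    refine hasFreePair_of_transitive_pair B (w := w) hv (fun x => ?_) fun x => ?_
    · obtain ⟨d, hd, hdv⟩ := htrans v hv x
      -- Since `e b w = w` and `b v = 0`, the factor `1 - e * b` kills `w` and fixes `v`.
      refine ⟨d * (1 - e * b), B.mul_mem hd (B.sub_mem B.one_mem (B.mul_mem he hb)), ?_, ?_⟩
      · simp [hbv, hdv]
      · simp [hew]
    · obtain ⟨d, hd, hdw⟩ := htrans _ hbw x
      exact ⟨d * b, B.mul_mem hd hb, by simp [hdw], by simp [hbv]⟩

/-- A ring that is noncommutative modulo its Jacobson radical has a maximal left ideal which does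
not contain all commutators. -/
theorem NoncommutativeModJacobson.exists_isMaximal {R : Type*} [Ring R]
    (hR : NoncommutativeModJacobson R) :
    ∃ I : Ideal R, I.IsMaximal ∧ ∃ x y : R, x * y - y * x ∉ I := by
  obtain ⟨x, y, hxy⟩ := hR
  obtain ⟨x, rfl⟩ := Ideal.Quotient.mk_surjective x
  obtain ⟨y, rfl⟩ := Ideal.Quotient.mk_surjective y
  rw [← map_mul, ← map_mul, Ne, Ideal.Quotient.eq, Ring.jacobson_eq_sInf_isMaximal,
    Submodule.mem_sInf] at hxy
  push Not at hxy
  obtain ⟨I, hI, h⟩ := hxy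
  exact ⟨I, hI, x, y, h⟩

/-- An algebra over an uncountable field that is noncommutative modulo its Jacobson radical has a
free pair. -/
theorem NoncommutativeModJacobson.hasFreePair (k : Type*) [Field k] [Uncountable k] {R : Type*}
    [Ring R] [Algebra k R] (hR : NoncommutativeModJacobson R) : HasFreePair R := by
  by_contra hfree
  obtain ⟨I, hI, x, y, hxy⟩ := hR.exists_isMaximal
  have : IsSimpleModule R (R ⧸ I) := isSimpleModule_iff_isCoatom.2 (Ideal.isMaximal_def.1 hI)
  let ρ : R →ₐ[k] Module.End k (R ⧸ I) := Algebra.lsmul k k (R ⧸ I)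
  have hρ : ¬ HasFreePair ρ.range := fun h =>
    hfree (h.of_surjective (ρ.rangeRestrict : R →* ρ.range) ρ.rangeRestrict_surjective)
  obtain ⟨B, hB, hBfree, hcent⟩ := exists_le_not_hasFreePair_centralizer_le ρ.range hρ
  have hmem : ∀ r, ρ r ∈ B := fun r => hB ⟨r, rfl⟩
  refine hBfree (hasFreePair_of_centralizer_le B (fun v hv z => ?_) hcent (hmem x) (hmem y) ?_)
  · obtain ⟨r, hr⟩ := IsSimpleModule.toSpanSingleton_surjective R hv z
    exact ⟨ρ r, hmem r, hr⟩
  · intro h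
    rw [← map_mul, ← map_mul] at h
    have h1 : (x * y) • Submodule.Quotient.mk (p := I) 1 = (y * x) • Submodule.Quotient.mk 1 :=
      LinearMap.congr_fun h (Submodule.Quotient.mk 1)
    rw [← Submodule.Quotient.mk_smul, ← Submodule.Quotient.mk_smul, Submodule.Quotient.eq] at h1
    exact hxy (by simpa using h1)

theorem corollary4 {k : Type*} [Field k] [Uncountable k] {R : Type*} [Ring R] [Algebra k R]
    (hR : NoncommutativeModJacobson R) :
    ∃ S : Subsemigroup R, IsFreeNoncyclicSubsemigroup S :=
  (hR.hasFreePair k).exists_isFreeNoncyclicSubsemigroup
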